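/- Let $N\ge 2$, let $K$ be a complex Hilbert space and let $V_0,\dots,V_{N-1}$ be Cuntz isometries on $K$, i.e. $V_i^*V_j=\delta_{ij}I$ and $\sum_{i=0}^{N-1}V_iV_i^*=I$. Let $\mathcal T$ be a complete metric space and $e:\mathcal T\to K$, $t\mapsto e_t$, a continuous map with $\|e_t\|=1$ for all $t$ and such that the closed linear span of $\{e_t:t\in\mathcal T\}$ is $K$. Suppose that for every $i$ and $t$ we have $V_i^*e_t=\nu_i(t)e_{g_i(t)}$, where $\nu_i:\mathcal T\to\mathbb C$ and $g_i:\mathcal T\to\mathcal T$ are maps and each $g_i$ is a contraction (Lipschitz with a constant $<1$). A set $M\subseteq\mathcal T$ is invariant if $g_i(t)\in M$ whenever $t\in M$ and $\nu_i(t)\ne0$. A minimal compact invariant set is a nonempty compact invariant set that contains no other nonempty compact invariant set. Suppose that $\{V_i\}$ is reversing on these sets: for every minimal compact invariant set $M$, every $t\in M$ and every $i$ with $\nu_i(t)\neq0$, $V_ie_{g_i(t)}=\overline{\nu_i(t)}\,e_t$. For a finite word $\omega=\omega_1\cdots\omega_n$ with digits in $\{0,\dots,N-1\}$ (possibly the empty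 word) put $V_\omega=V_{\omega_1}\cdots V_{\omega_n}$, $g_\omega=g_{\omega_n}\circ\cdots\circ g_{\omega_1}$ and $\nu_\omega(t)=\nu_{\omega_1}(t)\,\nu_{\omega_2}(g_{\omega_1}(t))\cdots\nu_{\omega_n}(g_{\omega_1\cdots\omega_{n-1}}(t))$. A nonempty word $\beta$ is a cycle word for $c$ if $g_\beta(c)=c$, $\nu_\beta(c)\ne0$, and $g_\gamma(c)\neq c$ for every nonempty proper prefix $\gamma$ of $\beta$. Let $\Omega_c^{(0)}$ be the set of words that do not end in a cycle word for $c$. Then there are only finitely many minimal compact invariant sets $M_1,\dots,M_p$, and: 1. for every $i=1,\dots,p$, every $c\in M_i$ and every $j\in\{0,\dots,N-1\}$, $|\nu_j(c)|$ is $0$ or $1$; 2. for every choice of points $c_i\in M_i$, $i=1,\dots,p$, the family $(V_\omega e_{c_i})_{1\le i\le p,\ \omega\in\Omega_{c_i}^{(0)}}$ is an orthonormal basis of $K$. -/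

import Mathlib

namespace CuntzWalk

/-- `(V i)` are Cuntz isometries: `V i* V j = δ i j` and `∑ V i V i* = 1`. -/
def IsCuntz {K : Type*} [NormedAddCommGroup K] [InnerProductSpace ℂ K] [CompleteSpace K]
    {N : ℕ} (V : Fin N → K →L[ℂ] K) : Prop :=
  (∀ i j, ContinuousLinearMap.adjoint (V i) * V j = if i = j then 1 else 0) ∧
    ∑ i, V i * ContinuousLinearMap.adjoint (V i) = 1

/-- The operator `V_ω = V_{ω₁} ⋯ V_{ωₙ}` of a word `ω = ω₁…ωₙ`. -/
def wordOp {K : Type*} [NormedAddCommGroup K] [InnerProductSpace ℂ K]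
    {N : ℕ} (V : Fin N → K →L[ℂ] K) (ω : List (Fin N)) : K →L[ℂ] K :=
  (ω.map V).prod

/-- The point `g_ω(t) = g_{ωₙ}(⋯ g_{ω₁}(t) ⋯)`; the first digit acts first. -/
def wordMap {T : Type*} {N : ℕ} (g : Fin N → T → T) : List (Fin N) → T → T
  | [], t => t
  | i :: ω, t => wordMap g ω (g i t)

/-- The weight `ν_ω(t) = ν_{ω₁}(t) ν_{ω₂}(g_{ω₁}(t)) ⋯ ν_{ωₙ}(g_{ω₁…ωₙ₋₁}(t))`. -/
def wordWeight {T : Type*} {N : ℕ} (g : Fin N → T → T) (ν : Fin N → T → ℂ) :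
    List (Fin N) → T → ℂ
  | [], _ => 1
  | i :: ω, t => ν i t * wordWeight g ν ω (g i t)

/-- `M` is invariant: it contains `g i t` whenever `t ∈ M` and the transition `t → g i t` is
possible, that is, `ν i t ≠ 0`. -/
def IsInvariant {T : Type*} {N : ℕ} (g : Fin N → T → T) (ν : Fin N → T → ℂ)
    (M : Set T) : Prop :=
  ∀ t ∈ M, ∀ i, ν i t ≠ 0 → g i t ∈ M

/-- Minimal compact invariant sets: the minimal elements, under inclusion, among the nonempty
compact invariant sets. -/
def IsMinimalSet {T : Type*} [TopologicalSpace T] {N : ℕ} (g : Fin N → T → T)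
    (ν : Fin N → T → ℂ) (M : Set T) : Prop :=
  M.Nonempty ∧ IsCompact M ∧ IsInvariant g ν M ∧
    ∀ M' : Set T, M' ⊆ M → M'.Nonempty → IsCompact M' → IsInvariant g ν M' → M' = M

/-- `(V i)` is reversing on the part of the random walk that lives on `M`. -/
def IsReversingOn {K : Type*} [NormedAddCommGroup K] [InnerProductSpace ℂ K] {T : Type*}
    {N : ℕ} (V : Fin N → K →L[ℂ] K) (e : T → K) (g : Fin N → T → T) (ν : Fin N → T → ℂ)
    (M : Set T) : Prop :=
  ∀ t ∈ M, ∀ i, ν i t ≠ 0 → V i (e (g i t)) = (starRingEnd ℂ) (ν i t) • e t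

/-- `β` is a cycle word for `c`: it is nonempty, it leads from `c` back to `c` with nonzero
weight, and no nonempty proper prefix of it leads to `c`. -/
def IsCycleWord {T : Type*} {N : ℕ} (g : Fin N → T → T) (ν : Fin N → T → ℂ) (c : T)
    (β : List (Fin N)) : Prop :=
  β ≠ [] ∧ wordMap g β c = c ∧ wordWeight g ν β c ≠ 0 ∧
    ∀ γ : List (Fin N), γ <+: β → γ ≠ [] → γ ≠ β → wordMap g γ c ≠ c

/-- The set `Ω_c⁽⁰⁾` of the words that do not end in a cycle word for `c`. -/
def noCycleEnd {T : Type*} {N : ℕ} (g : Fin N → T → T) (ν : Fin N → T → ℂ) (c : T) :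
    Set (List (Fin N)) :=
  {ω | ¬ ∃ β : List (Fin N), IsCycleWord g ν c β ∧ β <:+ ω}

end CuntzWalk

/-!
The reversing property gives `V_ω e_t = conj (ν_ω s) e_s` for every possible path `ω` from `s` to
`t` inside a minimal set. Since the `V_ω` of two incomparable words have orthogonal ranges, at most
one move is possible at each point of a minimal set; and two points whose vectors are not
orthogonal admit the same moves. By contractivity, two such points that lie on cycles coincide.
Continuity of `e` and compactness then force the minimal sets to be finite cycles, finitely many in
all, whose points carry mutually orthogonal vectors, and orthonormality follows.

For completeness, let `P` be the projection onto the orthogonal complement of the vectors `V_ω e_s`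
with `s` in a minimal set. It commutes with every `V_i*`, so `t ↦ ‖P e_t‖ ^ 2` is the average of its
values after one step of the walk. Its maximum over a compact set stable under the `g_i` is
therefore attained on a whole minimal set, where it vanishes.
-/

namespace CuntzWalk

open Function Filter Topology
open ContinuousLinearMap (adjoint)
open scoped InnerProductSpace

section Paths

variable {T : Type*} {N : ℕ} {g : Fin N → T → T} {ν : Fin N → T → ℂ}

lemma wordMap_append (ω τ : List (Fin N)) (t : T) :
    wordMap g (ω ++ τ) t = wordMap g τ (wordMap g ω t) := by
  induction ω generalizing t with
  | nil => rfl
  | cons i _ ih => exact ih (g i t)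

lemma wordWeight_append (ω τ : List (Fin N)) (t : T) :
    wordWeight g ν (ω ++ τ) t = wordWeight g ν ω t * wordWeight g ν τ (wordMap g ω t) := by
  induction ω generalizing t with
  | nil => simp [wordWeight, wordMap]
  | cons i ω ih => simp [wordWeight, wordMap, ih, mul_assoc]

/-- The random walk can go from `s` to `t` along the digits of `ω`. -/
def IsPath (g : Fin N → T → T) (ν : Fin N → T → ℂ) (s : T) (ω : List (Fin N)) (t : T) : Prop :=
  wordWeight g ν ω s ≠ 0 ∧ wordMap g ω s = t

/-- A point to which the random walk can return in a positive number of steps. -/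
def IsCyclePoint (g : Fin N → T → T) (ν : Fin N → T → ℂ) (t : T) : Prop :=
  ∃ β ≠ [], IsPath g ν t β t

lemma IsPath.nil (t : T) : IsPath g ν t [] t :=
  ⟨one_ne_zero, rfl⟩

lemma isPath_cons {i : Fin N} {ω : List (Fin N)} {s t : T} :
    IsPath g ν s (i :: ω) t ↔ ν i s ≠ 0 ∧ IsPath g ν (g i s) ω t := by
  simp only [IsPath, wordWeight, wordMap, mul_ne_zero_iff, and_assoc]

lemma isPath_append {ω τ : List (Fin N)} {s u : T} :
    IsPath g ν s (ω ++ τ) u ↔ ∃ t, IsPath g ν s ω t ∧ IsPath g ν t τ u := by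
  simp only [IsPath, wordMap_append, wordWeight_append, mul_ne_zero_iff]
  exact ⟨fun ⟨⟨hω, hτ⟩, hu⟩ => ⟨_, ⟨hω, rfl⟩, hτ, hu⟩, fun ⟨_, ⟨hω, ht⟩, hτ, hu⟩ =>
    ht ▸ ⟨⟨hω, ht ▸ hτ⟩, ht ▸ hu⟩⟩

lemma IsPath.append {ω τ : List (Fin N)} {s t u : T} (hω : IsPath g ν s ω t)
    (hτ : IsPath g ν t τ u) : IsPath g ν s (ω ++ τ) u :=
  isPath_append.2 ⟨t, hω, hτ⟩

lemma IsPath.of_append_left {ω τ : List (Fin N)} {s t u : T} (h : IsPath g ν s (ω ++ τ) u)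
    (hω : IsPath g ν s ω t) : IsPath g ν t τ u := by
  obtain ⟨t', hω', hτ⟩ := isPath_append.1 h
  rwa [← hω.2, hω'.2]

lemma IsPath.exists_length_eq_mul {β : List (Fin N)} {t : T} (hβ : IsPath g ν t β t) (n : ℕ) :
    ∃ ω : List (Fin N), ω.length = n * β.length ∧ IsPath g ν t ω t := by
  induction n with
  | zero => exact ⟨[], by simp, .nil t⟩
  | succ n ih =>
    obtain ⟨ω, hlen, hω⟩ := ih
    exact ⟨ω ++ β, by simp [hlen, add_mul], hω.append hβ⟩

lemma exists_isPath_of_length (hν : ∀ t, ∃ i, ν i t ≠ 0) (n : ℕ) (s : T) :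
    ∃ (ω : List (Fin N)) (t : T), ω.length = n ∧ IsPath g ν s ω t := by
  induction n generalizing s with
  | zero => exact ⟨[], s, rfl, .nil s⟩
  | succ n ih =>
    obtain ⟨i, hi⟩ := hν s
    obtain ⟨ω, t, hlen, hω⟩ := ih (g i s)
    exact ⟨i :: ω, t, by simp [hlen], isPath_cons.2 ⟨hi, hω⟩⟩

lemma IsInvariant.mem_of_isPath {S : Set T} (hS : IsInvariant g ν S) {ω : List (Fin N)} {s t : T}
    (hs : s ∈ S) (h : IsPath g ν s ω t) : t ∈ S := by
  induction ω generalizing s with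
  | nil => exact h.2 ▸ hs
  | cons i ω ih =>
    obtain ⟨hi, hω⟩ := isPath_cons.1 h
    exact ih (hS s hs i hi) hω

lemma isInvariant_setOf_exists_isPath (s : T) : IsInvariant g ν {t | ∃ ω, IsPath g ν s ω t} :=
  fun t ⟨ω, hω⟩ i hi => ⟨ω ++ [i], hω.append (isPath_cons.2 ⟨hi, .nil (g i t)⟩)⟩

lemma isInvariant_sUnion {C : Set (Set T)} (hC : ∀ M ∈ C, IsInvariant g ν M) :
    IsInvariant g ν (⋃₀ C) :=
  fun t ⟨M, hM, ht⟩ i hi => ⟨M, hM, hC M hM t ht i hi⟩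

lemma isInvariant_inter_eq_of_isMaxOn {f : T → ℝ} (hν : ∀ t, ∑ i, ‖ν i t‖ ^ 2 = 1)
    (hf : ∀ t, f t ≤ ∑ i, ‖ν i t‖ ^ 2 * f (g i t)) {A : Set T} (hA : IsInvariant g ν A) {y : T}
    (hy : IsMaxOn f A y) : IsInvariant g ν (A ∩ {t | f t = f y}) := by
  rintro t ⟨htA, hty : f t = f y⟩ i hi
  refine ⟨hA t htA i hi, (hy (hA t htA i hi)).eq_of_not_lt fun hlt => ?_⟩
  have hle : ∀ j, ‖ν j t‖ ^ 2 * f (g j t) ≤ ‖ν j t‖ ^ 2 * f y := fun j => by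
    by_cases hj : ν j t = 0
    · simp [hj]
    · exact mul_le_mul_of_nonneg_left (hy (hA t htA j hj)) (by positivity)
  have hsum : ∑ j, ‖ν j t‖ ^ 2 * f (g j t) < ∑ j, ‖ν j t‖ ^ 2 * f y :=
    Finset.sum_lt_sum (fun j _ => hle j)
      ⟨i, Finset.mem_univ i, mul_lt_mul_of_pos_left hlt (by positivity)⟩
  rw [← Finset.sum_mul, hν, one_mul] at hsum
  exact ((hf t).trans_lt hsum).ne hty

lemma IsPath.exists_isCycleWord_suffix {c : T} {α : List (Fin N)} (hα : α ≠ [])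
    (h : IsPath g ν c α c) : ∃ β, IsCycleWord g ν c β ∧ β <:+ α := by
  by_cases hmin : ∀ γ : List (Fin N), γ <+: α → γ ≠ [] → γ ≠ α → wordMap g γ c ≠ c
  · exact ⟨α, ⟨hα, h.2, h.1, hmin⟩, List.suffix_rfl⟩
  · push Not at hmin
    obtain ⟨γ, ⟨δ, rfl⟩, hγ, hne, hc⟩ := hmin
    have hlen : δ.length < (γ ++ δ).length := by simpa using List.length_pos_of_ne_nil hγ
    have hδ : δ ≠ [] := by
      rintro rfl
      simp at hne
    obtain ⟨t, hγt, hδt⟩ := isPath_append.1 h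
    obtain rfl : t = c := hγt.2.symm.trans hc
    obtain ⟨β, hβ, hsuff⟩ := hδt.exists_isCycleWord_suffix hδ
    exact ⟨β, hβ, hsuff.trans (List.suffix_append γ δ)⟩
termination_by α.length

lemma mem_noCycleEnd_of_append {c : T} {ω α : List (Fin N)}
    (h : ω ++ α ∈ noCycleEnd g ν c) : α ∈ noCycleEnd g ν c :=
  fun ⟨β, hβ, hsuff⟩ => h ⟨β, hβ, hsuff.trans (List.suffix_append ω α)⟩

lemma IsPath.eq_nil_of_mem_noCycleEnd {c : T} {α : List (Fin N)} (h : IsPath g ν c α c)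
    (hα : α ∈ noCycleEnd g ν c) : α = [] := by
  by_contra hne
  exact hα (h.exists_isCycleWord_suffix hne)

end Paths

section MinimalSets

variable {T : Type*} [TopologicalSpace T] {N : ℕ} {g : Fin N → T → T} {ν : Fin N → T → ℂ}

lemma isInvariant_sUnion_isMinimalSet : IsInvariant g ν (⋃₀ {M | IsMinimalSet g ν M}) :=
  isInvariant_sUnion fun _ hM => hM.2.2.1

variable [T2Space T]

lemma exists_isMinimalSet_subset {A : Set T} (hne : A.Nonempty) (hA : IsCompact A)
    (hinv : IsInvariant g ν A) : ∃ M ⊆ A, IsMinimalSet g ν M := by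
  let P : Set (Set T) := {M | M.Nonempty ∧ IsCompact M ∧ IsInvariant g ν M}
  have hchain : ∀ C ⊆ P, IsChain (· ⊆ ·) C → C.Nonempty → ∃ L ∈ P, ∀ M ∈ C, L ⊆ M := by
    intro C hCP hC hCne
    have : Nonempty C := hCne.to_subtype
    have hclosed : ∀ M ∈ C, IsClosed M := fun M hM => (hCP hM).2.1.isClosed
    refine ⟨⋂₀ C, ⟨?_, ?_, ?_⟩, fun M hM => Set.sInter_subset_of_mem hM⟩
    · exact IsCompact.nonempty_sInter_of_directed_nonempty_isCompact_isClosed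
        (fun M hM M' hM' => (hC.total hM hM').elim (fun h => ⟨M, hM, subset_rfl, h⟩)
          fun h => ⟨M', hM', h, subset_rfl⟩)
        (fun M hM => (hCP hM).1) (fun M hM => (hCP hM).2.1) hclosed
    · obtain ⟨M, hM⟩ := hCne
      exact (hCP hM).2.1.of_isClosed_subset (isClosed_sInter hclosed)
        (Set.sInter_subset_of_mem hM)
    · exact fun t ht i hi M hM => (hCP hM).2.2 t (ht M hM) i hi
  obtain ⟨M, hMA, hM⟩ := zorn_superset_nonempty P hchain A ⟨hne, hA, hinv⟩
  exact ⟨M, hMA, hM.1.1, hM.1.2.1, hM.1.2.2, fun M' hsub h1 h2 h3 =>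
    hM.eq_of_subset ⟨h1, h2, h3⟩ hsub⟩

lemma IsMinimalSet.eq_of_mem {M M' : Set T} (hM : IsMinimalSet g ν M) (hM' : IsMinimalSet g ν M')
    {t : T} (ht : t ∈ M) (ht' : t ∈ M') : M = M' := by
  have hne : (M ∩ M').Nonempty := ⟨t, ht, ht'⟩
  have hcomp : IsCompact (M ∩ M') := hM.2.1.inter hM'.2.1
  have hinv : IsInvariant g ν (M ∩ M') := fun s hs i hi =>
    ⟨hM.2.2.1 s hs.1 i hi, hM'.2.2.1 s hs.2 i hi⟩
  exact (hM.2.2.2 _ Set.inter_subset_left hne hcomp hinv).symm.trans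
    (hM'.2.2.2 _ Set.inter_subset_right hne hcomp hinv)

lemma exists_isMinimalSet_forall_le {f : T → ℝ} (hfc : Continuous f)
    (hν : ∀ t, ∑ i, ‖ν i t‖ ^ 2 = 1) (hf : ∀ t, f t ≤ ∑ i, ‖ν i t‖ ^ 2 * f (g i t))
    {A : Set T} (hAc : IsCompact A) (hA : IsInvariant g ν A) {x : T} (hx : x ∈ A) :
    ∃ M, IsMinimalSet g ν M ∧ ∀ s ∈ M, f x ≤ f s := by
  obtain ⟨y, hyA, hy⟩ := hAc.exists_isMaxOn ⟨x, hx⟩ hfc.continuousOn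
  have hmax : IsCompact (A ∩ {t | f t = f y}) :=
    hAc.inter_right (isClosed_eq hfc continuous_const)
  obtain ⟨M, hMsub, hM⟩ := exists_isMinimalSet_subset (g := g) (ν := ν)
    (A := A ∩ {t | f t = f y}) ⟨y, hyA, rfl⟩ hmax
    (isInvariant_inter_eq_of_isMaxOn hν hf hA hy)
  exact ⟨M, hM, fun s hs => (hy hx).trans_eq (hMsub hs).2.symm⟩

end MinimalSets

section Contractions

variable {T : Type*} {k : NNReal}

lemma hausdorffEDist_image_le [PseudoEMetricSpace T] {f : T → T} (hf : LipschitzWith k f)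
    {s t : Set T} (hs : IsCompact s) (hs' : s.Nonempty) (ht : IsCompact t) (ht' : t.Nonempty) :
    Metric.hausdorffEDist (f '' s) (f '' t) ≤ k * Metric.hausdorffEDist s t := by
  have hnear : ∀ {s t : Set T}, IsCompact t → t.Nonempty → ∀ x ∈ f '' s,
      ∃ y ∈ f '' t, edist x y ≤ k * Metric.hausdorffEDist s t := by
    rintro s t ht ht' _ ⟨a, ha, rfl⟩
    obtain ⟨b, hb, hab⟩ := ht.exists_infEDist_eq_edist ht' a
    refine ⟨f b, ⟨b, hb, rfl⟩, (hf a b).trans ?_⟩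
    rw [← hab]
    gcongr
    exact Metric.infEDist_le_hausdorffEDist_of_mem ha
  refine Metric.hausdorffEDist_le_of_mem_edist (hnear ht ht') ?_
  rw [Metric.hausdorffEDist_comm]
  exact hnear hs hs'

open TopologicalSpace (NonemptyCompacts) in
/-- Hutchinson's argument: `C ↦ {x} ∪ ⋃ i, g i '' C` is a contraction for the Hausdorff
distance, and its fixed point is the required set. -/
lemma exists_isCompact_mapsTo [MetricSpace T] [CompleteSpace T] {ι : Type*} [Finite ι]
    {g : ι → T → T} (hk : k < 1) (hg : ∀ i, LipschitzWith k (g i)) (x : T) :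
    ∃ A : Set T, IsCompact A ∧ x ∈ A ∧ ∀ i, Set.MapsTo (g i) A A := by
  let Φ : NonemptyCompacts T → NonemptyCompacts T := fun C =>
    ⟨⟨{x} ∪ ⋃ i, g i '' C, isCompact_singleton.union <|
      isCompact_iUnion fun i => C.isCompact.image (hg i).continuous⟩, ⟨x, .inl rfl⟩⟩
  have hΦ : ContractingWith k Φ := by
    refine ⟨hk, fun C D => ?_⟩
    calc edist (Φ C) (Φ D)
        ≤ max (Metric.hausdorffEDist {x} {x})
            (Metric.hausdorffEDist (⋃ i, g i '' C) (⋃ i, g i '' D)) :=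
          Metric.hausdorffEDist_union_le
      _ ≤ k * edist C D := by
          rw [Metric.hausdorffEDist_self]
          refine max_le zero_le (Metric.hausdorffEDist_iUnion_le.trans (iSup_le fun i => ?_))
          exact hausdorffEDist_image_le (hg i) C.isCompact C.nonempty D.isCompact D.nonempty
  have : Nonempty (NonemptyCompacts T) := ⟨{x}⟩
  obtain ⟨A, hA⟩ : ∃ A, Φ A = A := ⟨_, hΦ.fixedPoint_isFixedPt⟩
  have hA' : {x} ∪ ⋃ i, g i '' A = (A : Set T) := congrArg SetLike.coe hA
  refine ⟨A, A.isCompact, hA' ▸ .inl rfl, fun i t ht => ?_⟩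
  rw [← hA']
  exact .inr (Set.mem_iUnion.2 ⟨i, t, ht, rfl⟩)

variable {N : ℕ} {g : Fin N → T → T}

lemma lipschitzWith_wordMap [PseudoEMetricSpace T] (hg : ∀ i, LipschitzWith k (g i))
    (ω : List (Fin N)) : LipschitzWith (k ^ ω.length) (wordMap g ω) := by
  induction ω with
  | nil =>
    rw [List.length_nil, pow_zero]
    exact LipschitzWith.id
  | cons i ω ih =>
    rw [List.length_cons, pow_succ]
    exact ih.comp (hg i)

lemma contractingWith_wordMap [EMetricSpace T] (hk : k < 1) (hg : ∀ i, LipschitzWith k (g i))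
    {β : List (Fin N)} (hβ : β ≠ []) : ContractingWith (k ^ β.length) (wordMap g β) :=
  ⟨pow_lt_one₀ zero_le hk (List.length_pos_of_ne_nil hβ).ne', lipschitzWith_wordMap hg β⟩

lemma mapsTo_wordMap {A : Set T} (hA : ∀ i, Set.MapsTo (g i) A A) (ω : List (Fin N)) :
    Set.MapsTo (wordMap g ω) A A := by
  induction ω with
  | nil => exact Set.mapsTo_id A
  | cons i ω ih => exact ih.comp (hA i)

lemma IsCyclePoint.mem_of_mapsTo [MetricSpace T] [CompleteSpace T] {ν : Fin N → T → ℂ}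
    (hk : k < 1) (hg : ∀ i, LipschitzWith k (g i)) {A : Set T} (hAc : IsClosed A)
    (hA : ∀ i, Set.MapsTo (g i) A A) (hne : A.Nonempty) {t : T} (ht : IsCyclePoint g ν t) :
    t ∈ A := by
  obtain ⟨β, hβ, -, hfix⟩ := ht
  obtain ⟨x, hx⟩ := hne
  have : Nonempty T := ⟨x⟩
  have hβk := contractingWith_wordMap hk hg hβ
  rw [hβk.fixedPoint_unique hfix]
  exact hAc.mem_of_tendsto (hβk.tendsto_iterate_fixedPoint x)
    (.of_forall fun n => (mapsTo_wordMap hA β).iterate n hx)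

lemma exists_forall_lipschitzWith {ι : Type*} [Finite ι] [EMetricSpace T] {g : ι → T → T}
    (hg : ∀ i, ∃ k, ContractingWith k (g i)) : ∃ k < 1, ∀ i, LipschitzWith k (g i) := by
  have := Fintype.ofFinite ι
  choose κ hκ using hg
  exact ⟨Finset.univ.sup κ, (Finset.sup_lt_iff one_pos).2 fun i _ => (hκ i).1,
    fun i => (hκ i).2.weaken (Finset.le_sup (Finset.mem_univ i))⟩

end Contractions

section Nonorthogonality

variable {𝕜 K T : Type*} [RCLike 𝕜] [NormedAddCommGroup K] [InnerProductSpace 𝕜 K]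
  [TopologicalSpace T] {e : T → K} {X : Set T}

lemma exists_lt_inner_ne_zero (he : Continuous e) (he0 : ∀ t, e t ≠ 0) (hX : IsCompact X)
    {x : ℕ → T} (hx : ∀ n, x n ∈ X) : ∃ m n, m < n ∧ ⟪e (x m), e (x n)⟫_𝕜 ≠ 0 := by
  obtain ⟨z, -, hz⟩ := hX.exists_mapClusterPt (f := atTop) (u := x)
    (tendsto_principal.2 (.of_forall hx))
  have hnear : ∀ᶠ p in 𝓝 z ×ˢ 𝓝 z, ⟪e p.1, e p.2⟫_𝕜 ≠ 0 := by
    rw [← nhds_prod_eq]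
    have hcont : Continuous fun p : T × T => ⟪e p.1, e p.2⟫_𝕜 := by fun_prop
    exact hcont.continuousAt.eventually_ne (inner_self_ne_zero.2 (he0 z))
  obtain ⟨U, hU, hinner⟩ := eventually_prod_self_iff'.1 hnear
  have hfreq : ∃ᶠ n in atTop, x n ∈ U := hz.frequently hU
  obtain ⟨m, hm⟩ := hfreq.exists
  obtain ⟨n, hmn, hn⟩ := frequently_atTop'.1 hfreq m
  exact ⟨m, n, hmn, hinner _ hm _ hn⟩

lemma finite_of_pairwise_inner_eq_zero (he : Continuous e) (he0 : ∀ t, e t ≠ 0)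
    (hX : IsCompact X) {A : Set T} (hAX : A ⊆ X) (hA : A.Pairwise fun s t => ⟪e s, e t⟫_𝕜 = 0) :
    A.Finite := by
  by_contra hinf
  let x := Set.Infinite.natEmbedding A hinf
  obtain ⟨m, n, hmn, hinner⟩ := exists_lt_inner_ne_zero (𝕜 := 𝕜) he he0 hX
    (x := fun n => (x n : T)) fun n => hAX (x n).2
  exact hinner (hA (x m).2 (x n).2 fun h => hmn.ne (x.injective (Subtype.ext h)))

end Nonorthogonality

section WordOperators

variable {K : Type*} [NormedAddCommGroup K] [InnerProductSpace ℂ K] {N : ℕ}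
  {V : Fin N → K →L[ℂ] K}

lemma wordOp_append (ω τ : List (Fin N)) (x : K) :
    wordOp V (ω ++ τ) x = wordOp V ω (wordOp V τ x) := by
  simp [wordOp]

lemma wordOp_cons (i : Fin N) (ω : List (Fin N)) (x : K) :
    wordOp V (i :: ω) x = V i (wordOp V ω x) := by
  simp [wordOp]

variable [CompleteSpace K]

lemma IsCuntz.adjoint_apply (hV : IsCuntz V) (i j : Fin N) (x : K) :
    adjoint (V i) (V j x) = if i = j then x else 0 := by
  have h := DFunLike.congr_fun (hV.1 i j) x
  split_ifs with hij <;> simpa [hij] using h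

lemma IsCuntz.inner_apply (hV : IsCuntz V) (i j : Fin N) (x y : K) :
    ⟪V i x, V j y⟫_ℂ = if i = j then ⟪x, y⟫_ℂ else 0 := by
  rw [← ContinuousLinearMap.adjoint_inner_right, hV.adjoint_apply]
  split_ifs <;> simp

lemma IsCuntz.sum_norm_adjoint_sq (hV : IsCuntz V) (x : K) :
    ∑ i, ‖adjoint (V i) x‖ ^ 2 = ‖x‖ ^ 2 := by
  have h := congrArg (fun A : K →L[ℂ] K => ⟪x, A x⟫_ℂ) hV.2
  simp only [sum_apply, mul_apply_eq_comp, inner_sum,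
    ← ContinuousLinearMap.adjoint_inner_left, one_apply_eq_self,
    inner_self_eq_norm_sq_to_K] at h
  exact_mod_cast h

lemma IsCuntz.norm_apply (hV : IsCuntz V) (i : Fin N) (x : K) : ‖V i x‖ = ‖x‖ := by
  have h : ⟪V i x, V i x⟫_ℂ = ⟪x, x⟫_ℂ := by rw [hV.inner_apply, if_pos rfl]
  rw [norm_eq_sqrt_re_inner (𝕜 := ℂ), h, ← norm_eq_sqrt_re_inner]

lemma IsCuntz.norm_wordOp (hV : IsCuntz V) (ω : List (Fin N)) (x : K) :
    ‖wordOp V ω x‖ = ‖x‖ := by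
  induction ω with
  | nil => simp [wordOp]
  | cons i ω ih => rw [wordOp_cons, hV.norm_apply, ih]

lemma IsCuntz.prefix_of_inner_ne_zero (hV : IsCuntz V) {ω τ : List (Fin N)} {x y : K}
    (h : ⟪wordOp V ω x, wordOp V τ y⟫_ℂ ≠ 0) :
    (∃ α, τ = ω ++ α ∧ ⟪x, wordOp V α y⟫_ℂ ≠ 0) ∨
      ∃ α, ω = τ ++ α ∧ ⟪wordOp V α x, y⟫_ℂ ≠ 0 := by
  induction ω generalizing τ with
  | nil => exact .inl ⟨τ, rfl, by simpa [wordOp] using h⟩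
  | cons i ω ih =>
    cases τ with
    | nil => exact .inr ⟨i :: ω, rfl, by simpa [wordOp] using h⟩
    | cons j τ =>
      rw [wordOp_cons, wordOp_cons, hV.inner_apply] at h
      obtain ⟨rfl, hωτ⟩ := ite_ne_right_iff.1 h
      rcases ih hωτ with ⟨α, rfl, hα⟩ | ⟨α, rfl, hα⟩
      · exact .inl ⟨α, rfl, hα⟩
      · exact .inr ⟨α, rfl, hα⟩

variable {T : Type*} {e : T → K} {g : Fin N → T → T} {ν : Fin N → T → ℂ}

lemma inner_wordOp (hVe : ∀ i t, adjoint (V i) (e t) = ν i t • e (g i t)) (ω : List (Fin N)) (t : T)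
    (y : K) :
    ⟪e t, wordOp V ω y⟫_ℂ =
      starRingEnd ℂ (wordWeight g ν ω t) * ⟪e (wordMap g ω t), y⟫_ℂ := by
  induction ω generalizing t with
  | nil => simp [wordOp, wordWeight, wordMap]
  | cons i ω ih =>
    rw [wordOp_cons, ← ContinuousLinearMap.adjoint_inner_left, hVe, inner_smul_left, ih,
      wordWeight, map_mul, mul_assoc, wordMap]

lemma isPath_of_inner_wordOp_ne_zero (hVe : ∀ i t, adjoint (V i) (e t) = ν i t • e (g i t))
    {ω : List (Fin N)} {t : T} {y : K} (h : ⟪e t, wordOp V ω y⟫_ℂ ≠ 0) :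
    IsPath g ν t ω (wordMap g ω t) ∧ ⟪e (wordMap g ω t), y⟫_ℂ ≠ 0 := by
  rw [inner_wordOp hVe, mul_ne_zero_iff, map_ne_zero] at h
  exact ⟨⟨h.1, rfl⟩, h.2⟩

lemma IsCuntz.sum_norm_weight_sq (hV : IsCuntz V)
    (hVe : ∀ i t, adjoint (V i) (e t) = ν i t • e (g i t)) (he1 : ∀ t, ‖e t‖ = 1) (t : T) :
    ∑ i, ‖ν i t‖ ^ 2 = 1 := by
  simpa [hVe, norm_smul, he1] using hV.sum_norm_adjoint_sq (e t)

lemma IsCuntz.exists_weight_ne_zero (hV : IsCuntz V)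
    (hVe : ∀ i t, adjoint (V i) (e t) = ν i t • e (g i t)) (he0 : ∀ t, e t ≠ 0) (t : T) :
    ∃ i, ν i t ≠ 0 := by
  by_contra! hν
  have h : 0 = ‖e t‖ ^ 2 := by simpa [hVe, hν] using hV.sum_norm_adjoint_sq (e t)
  exact he0 t (by simpa using h.symm)

end WordOperators

section Reversing

variable {K : Type*} [NormedAddCommGroup K] [InnerProductSpace ℂ K] {T : Type*} {N : ℕ}
  {V : Fin N → K →L[ℂ] K} {e : T → K} {g : Fin N → T → T} {ν : Fin N → T → ℂ} {S : Set T}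

lemma isReversingOn_sUnion {C : Set (Set T)} (hC : ∀ M ∈ C, IsReversingOn V e g ν M) :
    IsReversingOn V e g ν (⋃₀ C) :=
  fun t ⟨M, hM, ht⟩ => hC M hM t ht

lemma IsReversingOn.wordOp_apply (hrev : IsReversingOn V e g ν S) (hS : IsInvariant g ν S)
    {ω : List (Fin N)} {s t : T} (hs : s ∈ S) (h : IsPath g ν s ω t) :
    wordOp V ω (e t) = starRingEnd ℂ (wordWeight g ν ω s) • e s := by
  induction ω generalizing s with
  | nil => simp [wordOp, wordWeight, ← h.2, wordMap]
  | cons i ω ih =>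
    obtain ⟨hi, hω⟩ := isPath_cons.1 h
    rw [wordOp_cons, ih (hS s hs i hi) hω, map_smul, hrev s hs i hi, smul_smul, wordWeight,
      map_mul, mul_comm]

variable [CompleteSpace K]

lemma IsReversingOn.norm_weight (hV : IsCuntz V) (he1 : ∀ t, ‖e t‖ = 1)
    (hrev : IsReversingOn V e g ν S) {t : T} (ht : t ∈ S) {i : Fin N} (hi : ν i t ≠ 0) :
    ‖ν i t‖ = 1 := by
  have h := congrArg norm (hrev t ht i hi)
  rw [hV.norm_apply, norm_smul, he1, he1] at h
  simpa using h.symm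

/-- Possible moves from `s` are also possible from every point that is not orthogonal to `s`,
and they preserve nonorthogonality. -/
lemma IsReversingOn.isPath_of_inner_ne_zero (hVe : ∀ i t, adjoint (V i) (e t) = ν i t • e (g i t))
    (hrev : IsReversingOn V e g ν S) (hS : IsInvariant g ν S) {ω : List (Fin N)} {r s t : T}
    (hs : s ∈ S) (h : IsPath g ν s ω t) (hrs : ⟪e r, e s⟫_ℂ ≠ 0) :
    IsPath g ν r ω (wordMap g ω r) ∧ ⟪e (wordMap g ω r), e t⟫_ℂ ≠ 0 := by
  refine isPath_of_inner_wordOp_ne_zero hVe ?_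
  rw [hrev.wordOp_apply hS hs h, inner_smul_right]
  exact mul_ne_zero ((map_ne_zero _).2 h.1) hrs

lemma IsReversingOn.prefix_or_prefix (hV : IsCuntz V) (he0 : ∀ t, e t ≠ 0)
    (hrev : IsReversingOn V e g ν S) (hS : IsInvariant g ν S) {ω τ : List (Fin N)} {s t u : T}
    (hs : s ∈ S) (hω : IsPath g ν s ω t) (hτ : IsPath g ν s τ u) : ω <+: τ ∨ τ <+: ω := by
  have h : ⟪wordOp V ω (e t), wordOp V τ (e u)⟫_ℂ ≠ 0 := by
    rw [hrev.wordOp_apply hS hs hω, hrev.wordOp_apply hS hs hτ, inner_smul_left,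
      inner_smul_right]
    simpa [he0] using And.intro hω.1 hτ.1
  rcases hV.prefix_of_inner_ne_zero h with ⟨α, rfl, -⟩ | ⟨α, rfl, -⟩
  · exact .inl (List.prefix_append ω α)
  · exact .inr (List.prefix_append τ α)

lemma IsReversingOn.prefix_of_length_le (hV : IsCuntz V) (he0 : ∀ t, e t ≠ 0)
    (hrev : IsReversingOn V e g ν S) (hS : IsInvariant g ν S) {ω τ : List (Fin N)} {s t u : T}
    (hs : s ∈ S) (hω : IsPath g ν s ω t) (hτ : IsPath g ν s τ u) (hlen : ω.length ≤ τ.length) :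
    ω <+: τ := by
  rcases hrev.prefix_or_prefix hV he0 hS hs hω hτ with h | h
  · exact h
  · exact (h.eq_of_length_le hlen).symm ▸ List.prefix_rfl

lemma IsReversingOn.exists_isPath_return (hV : IsCuntz V) (he0 : ∀ t, e t ≠ 0)
    (hrev : IsReversingOn V e g ν S) (hS : IsInvariant g ν S) {γ : List (Fin N)} {s t : T}
    (hs : s ∈ S) (hcyc : IsCyclePoint g ν s) (hγ : IsPath g ν s γ t) :
    ∃ δ ≠ [], IsPath g ν t δ s := by
  obtain ⟨β, hβ, hloop⟩ := hcyc
  obtain ⟨ω, hlen, hω⟩ := hloop.exists_length_eq_mul (γ.length + 1)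
  have hlt : γ.length < ω.length := by
    rw [hlen]
    exact Nat.lt_of_succ_le (Nat.le_mul_of_pos_right _ (List.length_pos_of_ne_nil hβ))
  obtain ⟨δ, rfl⟩ := hrev.prefix_of_length_le hV he0 hS hs hγ hω hlt.le
  refine ⟨δ, ?_, hω.of_append_left hγ⟩
  rintro rfl
  simp at hlt

variable [MetricSpace T] {k : NNReal}

lemma IsReversingOn.eq_of_inner_ne_zero (hV : IsCuntz V)
    (hVe : ∀ i t, adjoint (V i) (e t) = ν i t • e (g i t)) (he0 : ∀ t, e t ≠ 0) (hk : k < 1)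
    (hg : ∀ i, LipschitzWith k (g i)) (hrev : IsReversingOn V e g ν S) (hS : IsInvariant g ν S)
    {s t : T} (hs : s ∈ S) (ht : t ∈ S) (hsc : IsCyclePoint g ν s) (htc : IsCyclePoint g ν t)
    (hst : ⟪e s, e t⟫_ℂ ≠ 0) : s = t := by
  obtain ⟨β, hβ, hβs⟩ := hsc
  obtain ⟨τ, hτ, hτt⟩ := htc
  obtain ⟨ω, hωlen, hωs⟩ := hβs.exists_length_eq_mul τ.length
  obtain ⟨ω', hω'len, hω't⟩ := hτt.exists_length_eq_mul β.length
  have hlen : ω.length = ω'.length := by rw [hωlen, hω'len, mul_comm]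
  have hω's := (hrev.isPath_of_inner_ne_zero hVe hS ht hω't hst).1
  obtain rfl : ω = ω' :=
    (hrev.prefix_of_length_le hV he0 hS hs hωs hω's hlen.le).eq_of_length hlen
  have hω : ω ≠ [] := by
    rw [← List.length_pos_iff, hωlen]
    exact Nat.mul_pos (List.length_pos_of_ne_nil hτ) (List.length_pos_of_ne_nil hβ)
  exact (contractingWith_wordMap hk hg hω).fixedPoint_unique' hωs.2 hω't.2

variable [CompleteSpace T]

lemma IsReversingOn.finite_setOf_isCyclePoint (hV : IsCuntz V)
    (hVe : ∀ i t, adjoint (V i) (e t) = ν i t • e (g i t)) (he : Continuous e)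
    (he0 : ∀ t, e t ≠ 0) (hk : k < 1) (hg : ∀ i, LipschitzWith k (g i))
    (hrev : IsReversingOn V e g ν S) (hS : IsInvariant g ν S) :
    {t ∈ S | IsCyclePoint g ν t}.Finite := by
  obtain hempty | ⟨x, -⟩ := S.eq_empty_or_nonempty
  · simp [hempty]
  obtain ⟨A, hAc, hxA, hA⟩ := exists_isCompact_mapsTo hk hg x
  refine finite_of_pairwise_inner_eq_zero (𝕜 := ℂ) he he0 hAc
    (fun t ht => ht.2.mem_of_mapsTo hk hg hAc.isClosed hA ⟨x, hxA⟩) fun s hs t ht hne => ?_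
  by_contra hst
  exact hne (hrev.eq_of_inner_ne_zero hV hVe he0 hk hg hS hs.1 ht.1 hs.2 ht.2 hst)

/-- Iterating `g_β` from `y` converges to the required point, because each step is possible at
one iterate if it is possible at the previous one. -/
lemma IsReversingOn.exists_isPath_self
    (hVe : ∀ i t, adjoint (V i) (e t) = ν i t • e (g i t)) (he : Continuous e)
    (he0 : ∀ t, e t ≠ 0) (hk : k < 1) (hg : ∀ i, LipschitzWith k (g i))
    (hrev : IsReversingOn V e g ν S) (hS : IsInvariant g ν S) (hSc : IsClosed S) {y y' : T}
    {β : List (Fin N)} (hβ : β ≠ []) (hy : y ∈ S) (hpath : IsPath g ν y β y')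
    (hinner : ⟪e y', e y⟫_ℂ ≠ 0) : ∃ z ∈ S, IsPath g ν z β z := by
  have : Nonempty T := ⟨y⟩
  have hβk := contractingWith_wordMap hk hg hβ
  set f := wordMap g β
  set z := ContractingWith.fixedPoint f hβk
  have hstep : ∀ n, f^[n] y ∈ S ∧ IsPath g ν (f^[n] y) β (f^[n + 1] y) ∧
      ⟪e (f^[n + 1] y), e (f^[n] y)⟫_ℂ ≠ 0 := by
    intro n
    induction n with
    | zero => exact ⟨hy, ⟨hpath.1, rfl⟩, by simpa [f, hpath.2] using hinner⟩
    | succ n ih =>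
      obtain ⟨hmem, hn, hnonorth⟩ := ih
      simp only [iterate_succ_apply' f (n + 1)]
      exact ⟨hS.mem_of_isPath hmem hn, hrev.isPath_of_inner_ne_zero hVe hS hmem hn hnonorth⟩
  have hlim : Tendsto (fun n => f^[n] y) atTop (𝓝 z) := hβk.tendsto_iterate_fixedPoint y
  have hnear : ∀ᶠ n in atTop, ⟪e z, e (f^[n] y)⟫_ℂ ≠ 0 :=
    (tendsto_const_nhds.inner ((he.tendsto z).comp hlim)).eventually_ne
      (inner_self_ne_zero.2 (he0 z))
  obtain ⟨n, hn⟩ := hnear.exists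
  have hz := (hrev.isPath_of_inner_ne_zero hVe hS (hstep n).1 (hstep n).2.1 hn).1
  exact ⟨z, hSc.mem_of_tendsto hlim (.of_forall fun n => (hstep n).1), hz.1,
    hβk.fixedPoint_isFixedPt⟩

lemma IsReversingOn.exists_isCyclePoint (hV : IsCuntz V)
    (hVe : ∀ i t, adjoint (V i) (e t) = ν i t • e (g i t)) (he : Continuous e)
    (he0 : ∀ t, e t ≠ 0) (hk : k < 1) (hg : ∀ i, LipschitzWith k (g i))
    (hrev : IsReversingOn V e g ν S) (hS : IsInvariant g ν S) (hSc : IsCompact S)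
    (hne : S.Nonempty) : ∃ z ∈ S, IsCyclePoint g ν z := by
  obtain ⟨y, hy⟩ := hne
  choose ω t hlen hpath using
    fun n => exists_isPath_of_length (hV.exists_weight_ne_zero hVe he0) n y
  have ht : ∀ n, t n ∈ S := fun n => hS.mem_of_isPath hy (hpath n)
  obtain ⟨m, n, hmn, hinner⟩ := exists_lt_inner_ne_zero (𝕜 := ℂ) he he0 hSc ht
  obtain ⟨β, hβ⟩ := hrev.prefix_of_length_le hV he0 hS hy (hpath m) (hpath n)
    (by simpa [hlen] using hmn.le)
  have hβne : β ≠ [] := by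
    rintro rfl
    have := congrArg List.length hβ
    simp [hlen, hmn.ne] at this
  have hmn : IsPath g ν (t m) β (t n) := (hβ ▸ hpath n).of_append_left (hpath m)
  obtain ⟨z, hz, hzβ⟩ := hrev.exists_isPath_self hVe he he0 hk hg hS hSc.isClosed hβne (ht m)
    hmn (inner_eq_zero_symm.not.1 hinner)
  exact ⟨z, hz, β, hβne, hzβ⟩

lemma IsMinimalSet.exists_forall_isPath (hV : IsCuntz V)
    (hVe : ∀ i t, adjoint (V i) (e t) = ν i t • e (g i t)) (he : Continuous e)
    (he0 : ∀ t, e t ≠ 0) (hk : k < 1) (hg : ∀ i, LipschitzWith k (g i)) {M : Set T}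
    (hM : IsMinimalSet g ν M) (hrev : IsReversingOn V e g ν M) :
    ∃ z ∈ M, IsCyclePoint g ν z ∧ ∀ t ∈ M, ∃ γ, IsPath g ν z γ t := by
  obtain ⟨hne, hMc, hinv, hmin⟩ := hM
  obtain ⟨z, hz, hzc⟩ := hrev.exists_isCyclePoint hV hVe he he0 hk hg hinv hMc hne
  have hsub : {t | ∃ γ, IsPath g ν z γ t} ⊆ M := fun t ⟨γ, hγ⟩ => hinv.mem_of_isPath hz hγ
  have hfin : {t | ∃ γ, IsPath g ν z γ t}.Finite := by
    refine (hrev.finite_setOf_isCyclePoint hV hVe he he0 hk hg hinv).subset fun t ht => ?_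
    obtain ⟨γ, hγ⟩ := ht
    obtain ⟨δ, hδ, hback⟩ := hrev.exists_isPath_return hV he0 hinv hz hzc hγ
    exact ⟨hsub ⟨γ, hγ⟩, δ ++ γ, by simp [hδ], hback.append hγ⟩
  have horbit := hmin _ hsub ⟨z, [], .nil z⟩ hfin.isCompact (isInvariant_setOf_exists_isPath z)
  exact ⟨z, hz, hzc, fun t ht => horbit.ge ht⟩

lemma IsMinimalSet.exists_isPath (hV : IsCuntz V)
    (hVe : ∀ i t, adjoint (V i) (e t) = ν i t • e (g i t)) (he : Continuous e)
    (he0 : ∀ t, e t ≠ 0) (hk : k < 1) (hg : ∀ i, LipschitzWith k (g i)) {M : Set T}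
    (hM : IsMinimalSet g ν M) (hrev : IsReversingOn V e g ν M) {s t : T} (hs : s ∈ M)
    (ht : t ∈ M) : ∃ γ ≠ [], IsPath g ν s γ t := by
  obtain ⟨z, hz, hzc, hreach⟩ := hM.exists_forall_isPath hV hVe he he0 hk hg hrev
  obtain ⟨γ, hγ⟩ := hreach s hs
  obtain ⟨τ, hτ⟩ := hreach t ht
  obtain ⟨δ, hδ, hback⟩ := hrev.exists_isPath_return hV he0 hM.2.2.1 hz hzc hγ
  exact ⟨δ ++ τ, by simp [hδ], hback.append hτ⟩

end Reversing

section ReducingSubspaces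

variable {K : Type*} [NormedAddCommGroup K] [InnerProductSpace ℂ K] [CompleteSpace K] {N : ℕ}
  {V : Fin N → K →L[ℂ] K} {U : Submodule ℂ K} [U.HasOrthogonalProjection]

lemma IsCuntz.sum_norm_starProjection_adjoint_sq (hV : IsCuntz V)
    (hU : ∀ i, U ∈ Module.End.invtSubmodule (V i : K →ₗ[ℂ] K))
    (hU' : ∀ i, U ∈ Module.End.invtSubmodule (adjoint (V i) : K →ₗ[ℂ] K)) (x : K) :
    ∑ i, ‖U.starProjection (adjoint (V i) x)‖ ^ 2 = ‖U.starProjection x‖ ^ 2 := by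
  have hcomm : ∀ i, Commute U.starProjection (adjoint (V i)) := fun i => by
    refine (ContinuousLinearMap.IsIdempotentElem.commute_iff
      U.isIdempotentElem_starProjection).2 ⟨?_, ?_⟩
    · rw [U.range_starProjection]
      exact hU' i
    · rw [U.ker_starProjection]
      exact ContinuousLinearMap.orthogonal_mem_invtSubmodule (by simpa using hU i)
  rw [← hV.sum_norm_adjoint_sq (U.starProjection x)]
  exact Finset.sum_congr rfl fun i _ => congrArg (‖·‖ ^ 2) (DFunLike.congr_fun (hcomm i).eq x)

/-- The maximum principle for `t ↦ ‖P e_t‖ ^ 2`, where `P` is the projection onto `U`. -/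
lemma IsCuntz.eq_bot_of_forall_isMinimalSet {T : Type*} [MetricSpace T] [CompleteSpace T]
    {e : T → K} {g : Fin N → T → T} {ν : Fin N → T → ℂ} {k : NNReal} (hV : IsCuntz V)
    (hVe : ∀ i t, adjoint (V i) (e t) = ν i t • e (g i t)) (he : Continuous e)
    (he1 : ∀ t, ‖e t‖ = 1) (hspan : (Submodule.span ℂ (Set.range e)).topologicalClosure = ⊤)
    (hk : k < 1) (hg : ∀ i, LipschitzWith k (g i))
    (hU : ∀ i, U ∈ Module.End.invtSubmodule (V i : K →ₗ[ℂ] K))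
    (hU' : ∀ i, U ∈ Module.End.invtSubmodule (adjoint (V i) : K →ₗ[ℂ] K))
    (hmin : ∀ M, IsMinimalSet g ν M → ∀ t ∈ M, e t ∈ Uᗮ) : U = ⊥ := by
  have hharm : ∀ t, ‖U.starProjection (e t)‖ ^ 2 =
      ∑ i, ‖ν i t‖ ^ 2 * ‖U.starProjection (e (g i t))‖ ^ 2 := fun t => by
    rw [← hV.sum_norm_starProjection_adjoint_sq hU hU']
    simp only [hVe, map_smul, norm_smul, mul_pow]
  have hrange : Set.range e ⊆ Uᗮ := by
    rintro _ ⟨x, rfl⟩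
    obtain ⟨A, hAc, hxA, hA⟩ := exists_isCompact_mapsTo hk hg x
    obtain ⟨M, hM, hle⟩ := exists_isMinimalSet_forall_le
      (f := fun t => ‖U.starProjection (e t)‖ ^ 2) (by fun_prop)
      (hV.sum_norm_weight_sq hVe he1) (fun t => (hharm t).le) hAc (fun t ht i _ => hA i ht) hxA
    obtain ⟨s, hs⟩ := hM.1
    have hx := hle s hs
    rw [U.starProjection_apply_eq_zero_iff.2 (hmin M hM s hs), norm_zero] at hx
    refine U.starProjection_apply_eq_zero_iff.1 (norm_eq_zero.1 ?_)
    exact pow_eq_zero_iff two_ne_zero |>.1 (hx.trans_eq (by simp) |>.antisymm (by positivity))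
  have htop : ⊤ ≤ Uᗮ := hspan ▸ Submodule.topologicalClosure_minimal _
    (Submodule.span_le.2 hrange) U.isClosed_orthogonal
  exact U.orthogonal_eq_top_iff.1 (top_le_iff.1 htop)

end ReducingSubspaces

section WordSpan

variable {K : Type*} [NormedAddCommGroup K] [InnerProductSpace ℂ K] {T : Type*} {N : ℕ}
  {V : Fin N → K →L[ℂ] K} {e : T → K} {g : Fin N → T → T} {ν : Fin N → T → ℂ} {S : Set T}

/-- The span of the vectors `V_ω e_s` with `s ∈ S` and `ω` any word. -/
def wordSpan (V : Fin N → K →L[ℂ] K) (e : T → K) (S : Set T) : Submodule ℂ K :=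
  Submodule.span ℂ {x | ∃ ω, ∃ s ∈ S, wordOp V ω (e s) = x}

lemma wordOp_mem_wordSpan (ω : List (Fin N)) {s : T} (hs : s ∈ S) :
    wordOp V ω (e s) ∈ wordSpan V e S :=
  Submodule.subset_span ⟨ω, s, hs, rfl⟩

lemma wordSpan_mem_invtSubmodule (i : Fin N) :
    wordSpan V e S ∈ Module.End.invtSubmodule (V i : K →ₗ[ℂ] K) := by
  refine Submodule.span_le.2 ?_
  rintro _ ⟨ω, s, hs, rfl⟩
  change V i (wordOp V ω (e s)) ∈ wordSpan V e S
  rw [← wordOp_cons]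
  exact wordOp_mem_wordSpan (i :: ω) hs

lemma IsCuntz.wordSpan_mem_invtSubmodule_adjoint [CompleteSpace K] (hV : IsCuntz V)
    (hVe : ∀ i t, adjoint (V i) (e t) = ν i t • e (g i t)) (hS : IsInvariant g ν S) (i : Fin N) :
    wordSpan V e S ∈ Module.End.invtSubmodule (adjoint (V i) : K →ₗ[ℂ] K) := by
  refine Submodule.span_le.2 ?_
  rintro _ ⟨ω, s, hs, rfl⟩
  change adjoint (V i) (wordOp V ω (e s)) ∈ wordSpan V e S
  cases ω with
  | nil =>
    change adjoint (V i) (e s) ∈ wordSpan V e S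
    rw [hVe]
    by_cases hi : ν i s = 0
    · simp [hi]
    · exact Submodule.smul_mem _ _ (wordOp_mem_wordSpan [] (hS s hs i hi))
  | cons j ω =>
    rw [wordOp_cons, hV.adjoint_apply]
    split_ifs
    · exact wordOp_mem_wordSpan ω hs
    · exact Submodule.zero_mem _

/-- A cycle word at the end of `ω` acts on `e_c` as a scalar, so it can be removed. -/
lemma IsReversingOn.wordOp_mem_span_noCycleEnd (hrev : IsReversingOn V e g ν S)
    (hS : IsInvariant g ν S) {c : T} (hc : c ∈ S) (ω : List (Fin N)) :
    wordOp V ω (e c) ∈ Submodule.span ℂ ((fun τ => wordOp V τ (e c)) '' noCycleEnd g ν c) := by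
  induction hlen : ω.length using Nat.strong_induction_on generalizing ω with | h n ih =>
  by_cases hω : ω ∈ noCycleEnd g ν c
  · exact Submodule.subset_span ⟨ω, hω, rfl⟩
  · obtain ⟨β, ⟨hβ, hfix, hweight, -⟩, τ, hsplit⟩ := not_not.1 hω
    rw [← hsplit, wordOp_append, hrev.wordOp_apply hS hc ⟨hweight, hfix⟩, map_smul]
    have hlt : τ.length < n := by
      simpa [← hlen, ← hsplit] using List.length_pos_of_ne_nil hβ
    exact Submodule.smul_mem _ _ (ih _ hlt τ rfl)

variable {ι : Type*} {c : ι → T}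

lemma IsReversingOn.wordSpan_le (hrev : IsReversingOn V e g ν S) (hS : IsInvariant g ν S)
    (hreach : ∀ s ∈ S, ∃ i γ, IsPath g ν s γ (c i)) :
    wordSpan V e S ≤ Submodule.span ℂ
      (Set.range fun x : Σ i, noCycleEnd g ν (c i) => wordOp V x.2.1 (e (c x.1))) := by
  refine Submodule.span_le.2 ?_
  rintro _ ⟨ω, s, hs, rfl⟩
  obtain ⟨i, γ, hγ⟩ := hreach s hs
  have hmem := hrev.wordOp_mem_span_noCycleEnd hS (hS.mem_of_isPath hs hγ) (ω ++ γ)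
  rw [wordOp_append, hrev.wordOp_apply hS hs hγ, map_smul,
    Submodule.smul_mem_iff _ ((map_ne_zero _).2 hγ.1)] at hmem
  refine Submodule.span_mono ?_ hmem
  rintro _ ⟨τ, hτ, rfl⟩
  exact ⟨⟨i, τ, hτ⟩, rfl⟩

variable [CompleteSpace K]

lemma IsCuntz.orthonormal_wordOp_noCycleEnd (hV : IsCuntz V)
    (hVe : ∀ i t, adjoint (V i) (e t) = ν i t • e (g i t)) (he1 : ∀ t, ‖e t‖ = 1)
    (hc : ∀ i j ω t, IsPath g ν (c i) ω t → ⟪e t, e (c j)⟫_ℂ ≠ 0 → i = j ∧ t = c j) :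
    Orthonormal ℂ fun x : Σ i, noCycleEnd g ν (c i) => wordOp V x.2.1 (e (c x.1)) := by
  have hnil : ∀ {i j α}, ⟪e (c i), wordOp V α (e (c j))⟫_ℂ ≠ 0 → α ∈ noCycleEnd g ν (c j) →
      i = j ∧ α = [] := fun {i j α} h hα => by
    obtain ⟨hpath, hinner⟩ := isPath_of_inner_wordOp_ne_zero hVe h
    obtain ⟨rfl, ht⟩ := hc _ _ _ _ hpath hinner
    exact ⟨rfl, (ht ▸ hpath).eq_nil_of_mem_noCycleEnd hα⟩
  refine ⟨fun x => by rw [hV.norm_wordOp, he1], ?_⟩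
  rintro ⟨i, ω, hω⟩ ⟨j, τ, hτ⟩ hne
  by_contra h
  rcases hV.prefix_of_inner_ne_zero h with ⟨α, rfl, hα⟩ | ⟨α, rfl, hα⟩
  · obtain ⟨rfl, rfl⟩ := hnil hα (mem_noCycleEnd_of_append hτ)
    simp at hne
  · obtain ⟨rfl, rfl⟩ := hnil (inner_eq_zero_symm.not.1 hα) (mem_noCycleEnd_of_append hω)
    simp at hne

end WordSpan

section Main

variable {K : Type*} [NormedAddCommGroup K] [InnerProductSpace ℂ K] [CompleteSpace K]
  {T : Type*} [MetricSpace T] [CompleteSpace T] {N : ℕ} {V : Fin N → K →L[ℂ] K} {e : T → K}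
  {g : Fin N → T → T} {ν : Fin N → T → ℂ} {k : NNReal}

lemma IsMinimalSet.isCyclePoint (hV : IsCuntz V)
    (hVe : ∀ i t, adjoint (V i) (e t) = ν i t • e (g i t)) (he : Continuous e)
    (he0 : ∀ t, e t ≠ 0) (hk : k < 1) (hg : ∀ i, LipschitzWith k (g i)) {M : Set T}
    (hM : IsMinimalSet g ν M) (hrev : IsReversingOn V e g ν M) {t : T} (ht : t ∈ M) :
    IsCyclePoint g ν t :=
  hM.exists_isPath hV hVe he he0 hk hg hrev ht ht

lemma finite_setOf_isMinimalSet (hV : IsCuntz V)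
    (hVe : ∀ i t, adjoint (V i) (e t) = ν i t • e (g i t)) (he : Continuous e)
    (he0 : ∀ t, e t ≠ 0) (hk : k < 1) (hg : ∀ i, LipschitzWith k (g i))
    (hrev : ∀ M, IsMinimalSet g ν M → IsReversingOn V e g ν M) :
    {M | IsMinimalSet g ν M}.Finite := by
  have hfin : (⋃₀ {M | IsMinimalSet g ν M}).Finite :=
    ((isReversingOn_sUnion hrev).finite_setOf_isCyclePoint hV hVe he he0 hk hg
      isInvariant_sUnion_isMinimalSet).subset fun t ⟨M, hM, ht⟩ =>
        ⟨⟨M, hM, ht⟩, hM.isCyclePoint hV hVe he he0 hk hg (hrev M hM) ht⟩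
  exact hfin.finite_subsets.subset fun M hM => Set.subset_sUnion_of_mem hM

variable {c : {M : Set T // IsMinimalSet g ν M} → T}

lemma orthonormal_of_isMinimalSet (hV : IsCuntz V)
    (hVe : ∀ i t, adjoint (V i) (e t) = ν i t • e (g i t)) (he : Continuous e)
    (he1 : ∀ t, ‖e t‖ = 1) (hk : k < 1) (hg : ∀ i, LipschitzWith k (g i))
    (hrev : ∀ M, IsMinimalSet g ν M → IsReversingOn V e g ν M) (hc : ∀ M, c M ∈ M.1) :
    Orthonormal ℂ fun x : Σ M, noCycleEnd g ν (c M) => wordOp V x.2.1 (e (c x.1)) := by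
  have he0 : ∀ t, e t ≠ 0 := fun t => norm_ne_zero_iff.1 (by simp [he1])
  refine hV.orthonormal_wordOp_noCycleEnd hVe he1 fun M M' ω t hω hinner => ?_
  have ht : t ∈ M.1 := M.2.2.2.1.mem_of_isPath (hc M) hω
  obtain rfl : t = c M' := (isReversingOn_sUnion hrev).eq_of_inner_ne_zero hV hVe he0 hk hg
    isInvariant_sUnion_isMinimalSet ⟨M, M.2, ht⟩ ⟨M', M'.2, hc M'⟩
    (M.2.isCyclePoint hV hVe he he0 hk hg (hrev M M.2) ht)
    (M'.2.isCyclePoint hV hVe he he0 hk hg (hrev M' M'.2) (hc M')) hinner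
  exact ⟨Subtype.ext (M.2.eq_of_mem M'.2 ht (hc M')), rfl⟩

lemma orthogonal_span_eq_bot_of_isMinimalSet (hV : IsCuntz V)
    (hVe : ∀ i t, adjoint (V i) (e t) = ν i t • e (g i t)) (he : Continuous e)
    (he1 : ∀ t, ‖e t‖ = 1) (hspan : (Submodule.span ℂ (Set.range e)).topologicalClosure = ⊤)
    (hk : k < 1) (hg : ∀ i, LipschitzWith k (g i))
    (hrev : ∀ M, IsMinimalSet g ν M → IsReversingOn V e g ν M) (hc : ∀ M, c M ∈ M.1) :
    (Submodule.span ℂ (Set.range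
      fun x : Σ M, noCycleEnd g ν (c M) => wordOp V x.2.1 (e (c x.1))))ᗮ = ⊥ := by
  have he0 : ∀ t, e t ≠ 0 := fun t => norm_ne_zero_iff.1 (by simp [he1])
  set S := ⋃₀ {M | IsMinimalSet g ν M}
  have hS : IsInvariant g ν S := isInvariant_sUnion_isMinimalSet
  have hreach : ∀ s ∈ S, ∃ M γ, IsPath g ν s γ (c M) := by
    rintro s ⟨M, hM : IsMinimalSet g ν M, hs⟩
    obtain ⟨γ, -, hγ⟩ := hM.exists_isPath hV hVe he he0 hk hg (hrev M hM) hs (hc ⟨M, hM⟩)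
    exact ⟨⟨M, hM⟩, γ, hγ⟩
  have hle := (isReversingOn_sUnion hrev).wordSpan_le hS hreach
  refine le_bot_iff.1 ((Submodule.orthogonal_le hle).trans_eq ?_)
  refine hV.eq_bot_of_forall_isMinimalSet hVe he he1 hspan hk hg (fun i => ?_) (fun i => ?_)
    fun M hM s hs => Submodule.le_orthogonal_orthogonal _ (wordOp_mem_wordSpan [] ⟨M, hM, hs⟩)
  · exact ContinuousLinearMap.orthogonal_mem_invtSubmodule
      (hV.wordSpan_mem_invtSubmodule_adjoint hVe hS i)
  · refine ContinuousLinearMap.orthogonal_mem_invtSubmodule ?_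
    simpa using wordSpan_mem_invtSubmodule i

end Main

end CuntzWalk

theorem corollary3p23 {K : Type*} [NormedAddCommGroup K] [InnerProductSpace ℂ K]
    [CompleteSpace K] {T : Type*} [MetricSpace T] [CompleteSpace T]
    {N : ℕ} (hN : 2 ≤ N) (V : Fin N → K →L[ℂ] K) (hV : CuntzWalk.IsCuntz V)
    (e : T → K) (he : Continuous e) (he1 : ∀ t, ‖e t‖ = 1)
    (hspan : (Submodule.span ℂ (Set.range e)).topologicalClosure = ⊤)
    (g : Fin N → T → T) (ν : Fin N → T → ℂ)
    (hVe : ∀ i t, ContinuousLinearMap.adjoint (V i) (e t) = ν i t • e (g i t))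
    (hg : ∀ i, ∃ k : NNReal, ContractingWith k (g i))
    (hrev : ∀ M : Set T, CuntzWalk.IsMinimalSet g ν M → CuntzWalk.IsReversingOn V e g ν M) :
    {M : Set T | CuntzWalk.IsMinimalSet g ν M}.Finite ∧
    (∀ M : Set T, CuntzWalk.IsMinimalSet g ν M → ∀ c ∈ M, ∀ j, ‖ν j c‖ = 0 ∨ ‖ν j c‖ = 1) ∧
    ∀ c : {M : Set T // CuntzWalk.IsMinimalSet g ν M} → T, (∀ M, c M ∈ M.1) →
      ∃ b : HilbertBasis
          (Σ M : {M : Set T // CuntzWalk.IsMinimalSet g ν M}, CuntzWalk.noCycleEnd g ν (c M)) ℂ K,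
        ∀ x, b x = CuntzWalk.wordOp V x.2.1 (e (c x.1)) := by
  obtain ⟨k, hk, hgk⟩ := CuntzWalk.exists_forall_lipschitzWith hg
  have he0 : ∀ t, e t ≠ 0 := fun t => norm_ne_zero_iff.1 (by simp [he1])
  refine ⟨CuntzWalk.finite_setOf_isMinimalSet hV hVe he he0 hk hgk hrev, fun M hM c hc j => ?_,
    fun c hc => ?_⟩
  · by_cases hj : ν j c = 0
    · exact .inl (norm_eq_zero.2 hj)
    · exact .inr ((hrev M hM).norm_weight hV he1 hc hj)
  · have horth := CuntzWalk.orthonormal_of_isMinimalSet hV hVe he he1 hk hgk hrev hc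
    have htotal :=
      CuntzWalk.orthogonal_span_eq_bot_of_isMinimalSet hV hVe he he1 hspan hk hgk hrev hc
    exact ⟨.mkOfOrthogonalEqBot horth htotal, fun x => by
      rw [HilbertBasis.coe_mkOfOrthogonalEqBot]⟩
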